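/- Let $N\ge 1$ contents have request rates $\lambda_i>0$, miss costs $m_i\in\mathbb R$ and storage costs per unit time $c_i\in\mathbb R$, and let $$\mathcal C(T)=\sum_{i=1}^N\Big(c_i+(\lambda_i m_i-c_i)e^{-\lambda_i T}\Big)$$ be the long-run average cost, under Poisson requests (IRM model), of a TTL cache with timer $T$. Let $T_{\max}\ge 0$, let $\Pi_{[0,T_{\max}]}(x)=\min(\max(0,x),T_{\max})$, and let $(\epsilon(n))_{n\in\mathbb N}$ be nonnegative step sizes with $\sum_n\epsilon(n)=\infty$ and $\sum_n\epsilon(n)^2<\infty$ (so $\epsilon(n)\to0$). On a probability space with a filtration $(\mathcal F_n)_{n\in\mathbb N}$, let $T(0)$ be a real random variable that is $\mathcal F_0$-measurable (e.g. a constant). For each $n$ let $r(n)\in\{1,\dots,N\}$ (the content missed at step $n$) and $\hat\lambda_1(n),\dots,\hat\lambda_N(n)$ (real-valued estimates of the rates) be $\mathcal F_{n+1}$-measurable, and let $$T(n+1)=\Pi_{[0,T_{\max}]}\big(T(n)+\epsilon(n)X(n,T(n))\big),\qquad X(n,T(n))=\hat\lambda_{r(n)}(n)\,m_{r(n)}-c_{r(n)}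 .$$ Assume that, for all $n$ and $i$, almost surely, $$\mathbb P\big(r(n)=i\mid\mathcal F_n\big)=\frac{\lambda_i e^{-\lambda_i T(n)}}{\sum_{j=1}^N\lambda_j e^{-\lambda_j T(n)}},$$ that the estimates are unbiased given the past and the missed content, i.e. $\mathbb E\big[\hat\lambda_{r(n)}(n)\mid\mathcal F_n,r(n)\big]=\lambda_{r(n)}$ almost surely, and that $\sup_n\mathbb E\big[\hat\lambda_{r(n)}(n)^2\big]<\infty$. Then, almost surely, $T(n)$ converges to a (possibly random) point $x\in[0,T_{\max}]$ such that (i) $x$ is a stationary point of $\mathcal C$, i.e. $\mathcal C'(x)=0$; or (ii) $x=0$ and $0$ is a local minimum of $\mathcal C$ on $[0,T_{\max}]$, or $x=T_{\max}$ and $T_{\max}$ is a local minimum of $\mathcal C$ on $[0,T_{\max}]$. -/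

import Mathlib

open MeasureTheory ProbabilityTheory Filter Topology
open scoped NNReal ENNReal

noncomputable section

namespace TTL

/-- The long-run average cost rate of the TTL cache under the IRM model as a function of the
timer `t`: `C(t) = ∑ i, (c i + (lam i * m i - c i) * exp (-lam i * t))`. -/
def cost {N : ℕ} (lam m c : Fin N → ℝ) (t : ℝ) : ℝ :=
  ∑ i, (c i + (lam i * m i - c i) * Real.exp (-lam i * t))

/-- The probability that a miss is for content `i` when the timer is `t`. -/
def missProb {N : ℕ} (lam : Fin N → ℝ) (t : ℝ) (i : Fin N) : ℝ :=
  lam i * Real.exp (-lam i * t) / ∑ j, lam j * Real.exp (-lam j * t)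

/-- Projection of the real line onto `[0, Tmax]`. -/
def proj (Tmax x : ℝ) : ℝ := min (max 0 x) Tmax

/-- The correction applied at a miss for content `i` when the estimate of its rate is `est`. -/
def correction {N : ℕ} (m c : Fin N → ℝ) (i : Fin N) (est : ℝ) : ℝ := est * m i - c i

end TTL

end

/-! The mean correction at timer `t` is `drift`, and `C' = -missRate * drift` with `missRate > 0`,
so the recursion is a noisy projected gradient descent on the cost. Correction minus drift is a
martingale difference with bounded second moment; since the squared steps are summable, the weighted
noise series converges almost surely. From then on one path is fixed and the argument is
deterministic.

Adding to `T` the tail `R` of the noise series removes the noise: unless the projection acts, `T +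
R` moves by exactly `ε * g (T)`. In one dimension this forces convergence for any continuous `g`,
since an interval where `g` has constant weak sign can be crossed infinitely often in only one
direction (`exists_tendsto`). As the steps have infinite sum, a nonzero drift at the limit would
push the path away unless an endpoint stops it, and there the sign of `C'` gives a local minimum. -/

namespace TTL

/-! ### Deterministic projected recursions -/

lemma proj_mem {Tmax : ℝ} (h : 0 ≤ Tmax) (x : ℝ) : proj Tmax x ∈ Set.Icc 0 Tmax :=
  ⟨le_min (le_max_left _ _) h, min_le_right _ _⟩

lemma min_le_proj (Tmax x : ℝ) : min x Tmax ≤ proj Tmax x :=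
  min_le_min_right _ (le_max_right _ _)

lemma proj_reflect {Tmax : ℝ} (h : 0 ≤ Tmax) (x : ℝ) :
    proj Tmax (Tmax - x) = Tmax - proj Tmax x := by
  unfold proj
  rcases le_total 0 x with h0 | h0 <;> rcases le_total x Tmax with h1 | h1
  · rw [max_eq_right (by linarith), max_eq_right h0, min_eq_left h1, min_eq_left (by linarith)]
  · rw [max_eq_left (by linarith), max_eq_right h0, min_eq_right h1, min_eq_left h]; ring
  · rw [max_eq_right (by linarith), max_eq_left h0, min_eq_left h, min_eq_right (by linarith)]; ring
  · rw [max_eq_right (by linarith), max_eq_left h0, min_eq_left h, min_eq_right (by linarith)]; ring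

/-- The deterministic projected scheme `T (n + 1) = proj (T n + ε n * g (T n) + w n)` with vanishing
step sizes `ε` of infinite total mass, continuous drift `g` and summable-in-order noise `w`. -/
structure ProjectedScheme (Tmax : ℝ) (g : ℝ → ℝ) (ε w T : ℕ → ℝ) : Prop where
  Tmax_nonneg : 0 ≤ Tmax
  continuous_drift : Continuous g
  step_nonneg : ∀ n, 0 ≤ ε n
  step_tendsto : Tendsto ε atTop (𝓝 0)
  step_not_summable : ¬ Summable ε
  noise_converges : ∃ s, Tendsto (fun n => ∑ k ∈ Finset.range n, w k) atTop (𝓝 s)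
  update : ∀ n, T (n + 1) = proj Tmax (T n + (ε n * g (T n) + w n))

namespace ProjectedScheme

variable {Tmax : ℝ} {g : ℝ → ℝ} {ε w T : ℕ → ℝ}

/-- The symmetry `t ↦ Tmax - t` exchanges ascent with descent and the two endpoints, so each
one-sided estimate is proved only once. -/
lemma reflect (h : ProjectedScheme Tmax g ε w T) :
    ProjectedScheme Tmax (fun t => -g (Tmax - t)) ε (fun n => -w n) (fun n => Tmax - T n) where
  Tmax_nonneg := h.Tmax_nonneg
  continuous_drift := (h.continuous_drift.comp (continuous_const.sub continuous_id)).neg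
  step_nonneg := h.step_nonneg
  step_tendsto := h.step_tendsto
  step_not_summable := h.step_not_summable
  noise_converges := by
    obtain ⟨s, hs⟩ := h.noise_converges
    exact ⟨-s, by simpa using hs.neg⟩
  update n := by
    rw [h.update, ← proj_reflect h.Tmax_nonneg]
    congr 1
    simp only [sub_sub_cancel]
    ring

lemma mem_succ (h : ProjectedScheme Tmax g ε w T) (n : ℕ) : T (n + 1) ∈ Set.Icc 0 Tmax := by
  rw [h.update]
  exact proj_mem h.Tmax_nonneg _

lemma eventually_mem (h : ProjectedScheme Tmax g ε w T) :
    ∀ᶠ n in atTop, T n ∈ Set.Icc 0 Tmax := by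
  -- `T 0` is unconstrained; the projection confines all later terms.
  filter_upwards [eventually_ge_atTop 1] with n hn
  obtain ⟨k, rfl⟩ := Nat.exists_eq_add_of_le' hn
  exact h.mem_succ k

/-- The tails of the noise series. -/
lemma exists_tail (h : ProjectedScheme Tmax g ε w T) :
    ∃ R : ℕ → ℝ, Tendsto R atTop (𝓝 0) ∧ ∀ n, R n = w n + R (n + 1) := by
  obtain ⟨s, hs⟩ := h.noise_converges
  refine ⟨fun n => s - ∑ k ∈ Finset.range n, w k, ?_, fun n => ?_⟩
  · simpa using hs.const_sub s
  · simp only [Finset.sum_range_succ]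
    ring

lemma increment_tendsto (h : ProjectedScheme Tmax g ε w T) :
    Tendsto (fun n => ε n * g (T n) + w n) atTop (𝓝 0) := by
  have hw : Tendsto w atTop (𝓝 0) := by
    obtain ⟨R, hR, hRw⟩ := h.exists_tail
    have : w = fun n => R n - R (n + 1) := by
      funext n
      rw [hRw n]
      ring
    rw [this]
    simpa using hR.sub (hR.comp (tendsto_add_atTop_nat 1))
  obtain ⟨B, hB⟩ := (isCompact_Icc (a := (0 : ℝ)) (b := Tmax)).exists_bound_of_continuousOn
    h.continuous_drift.continuousOn
  have hg : Tendsto (fun n => ε n * g (T n)) atTop (𝓝 0) := by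
    refine squeeze_zero_norm' (a := fun n => ε n * B) ?_ (by simpa using h.step_tendsto.mul_const B)
    filter_upwards [h.eventually_mem] with n hn
    rw [norm_mul, Real.norm_of_nonneg (h.step_nonneg n)]
    exact mul_le_mul_of_nonneg_left (hB _ hn) (h.step_nonneg n)
  simpa using hg.add hw

/-- Where the drift is nonnegative on `[p, q]`, the scheme eventually does not descend from `q`
below `p`. -/
lemma eventually_no_descent (h : ProjectedScheme Tmax g ε w T) {p q : ℝ} (hpq : p < q)
    (hq : q ≤ Tmax) (hg : ∀ t ∈ Set.Icc p q, 0 ≤ g t) :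
    ∀ᶠ n in atTop, q ≤ T n → ∀ k ≥ n, p ≤ T k := by
  obtain ⟨R, hR, hRw⟩ := h.exists_tail
  obtain ⟨η, hη, hη'⟩ : ∃ η, 0 < η ∧ η * 10 = q - p := ⟨(q - p) / 10, by linarith, by ring⟩
  have hsmall : ∀ᶠ n in atTop, |R n| < η ∧ |ε n * g (T n) + w n| < η := by
    refine Eventually.and ?_ ?_
    · simpa using hR.abs.eventually_lt_const (by simpa using hη)
    · simpa using h.increment_tendsto.abs.eventually_lt_const (by simpa using hη)
  obtain ⟨n₀, hn₀⟩ := eventually_atTop.1 hsmall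
  filter_upwards [eventually_ge_atTop n₀] with n hn hqn
  -- The invariant bears on `T + R`, which cannot decrease while `T` is in `[p, q]`. From above `q`,
  -- or when clipped at `Tmax`, one step leaves it at least `q - 2 * η = p + 8 * η`.
  have key : ∀ k ≥ n, p + 2 * η ≤ T k + R k := by
    intro k hk
    induction k, hk using Nat.le_induction with
    | base =>
      have := abs_lt.1 (hn₀ n hn).1
      linarith
    | succ k hk ih =>
      have h1 := abs_lt.1 (hn₀ k (hn.trans hk)).1
      have h2 := abs_lt.1 (hn₀ k (hn.trans hk)).2
      have h3 := abs_lt.1 (hn₀ (k + 1) ((hn.trans hk).trans k.le_succ)).1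
      have hm := min_le_proj Tmax (T k + (ε k * g (T k) + w k))
      rw [← h.update] at hm
      rcases min_le_iff.1 hm with hm | hm
      · rcases le_or_gt (T k) q with hTq | hTq
        · have := mul_nonneg (h.step_nonneg k) (hg (T k) ⟨by linarith, hTq⟩)
          have := hRw k
          linarith
        · linarith
      · linarith
  intro k hk
  have := key k hk
  have := abs_lt.1 (hn₀ k (hn.trans hk)).1
  linarith

lemma eventually_no_ascent (h : ProjectedScheme Tmax g ε w T) {p q : ℝ} (hpq : p < q)
    (hp : 0 ≤ p) (hg : ∀ t ∈ Set.Icc p q, g t ≤ 0) :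
    ∀ᶠ n in atTop, T n ≤ p → ∀ k ≥ n, T k ≤ q := by
  filter_upwards [h.reflect.eventually_no_descent (p := Tmax - q) (q := Tmax - p) (by linarith)
    (by linarith) fun t ht => by
      have := hg (Tmax - t) ⟨by linarith [ht.2], by linarith [ht.1]⟩
      linarith] with n hn hnp k hk
  have := hn (by linarith) k hk
  linarith

lemma exists_tendsto (h : ProjectedScheme Tmax g ε w T) :
    ∃ x ∈ Set.Icc 0 Tmax, Tendsto T atTop (𝓝 x) := by
  suffices ∃ x, Tendsto T atTop (𝓝 x) by
    obtain ⟨x, hx⟩ := this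
    exact ⟨x, isClosed_Icc.mem_of_tendsto hx h.eventually_mem, hx⟩
  refine tendsto_of_no_upcrossings dense_univ ?_
    (isBoundedUnder_of_eventually_le (h.eventually_mem.mono fun n hn => hn.2))
    (isBoundedUnder_of_eventually_ge (h.eventually_mem.mono fun n hn => hn.1))
  rintro a - b - hab ⟨ha, hb⟩
  have ha0 : 0 < a := by
    obtain ⟨n, hn, hn'⟩ := (ha.and_eventually h.eventually_mem).exists
    exact hn'.1.trans_lt hn
  have hbT : b < Tmax := by
    obtain ⟨n, hn, hn'⟩ := (hb.and_eventually h.eventually_mem).exists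
    exact hn.trans_le hn'.2
  -- Infinitely many crossings of `(a, b)` are impossible either way: a point of negative drift has
  -- a neighbourhood blocking ascents, and otherwise the drift is nonnegative throughout and blocks
  -- descents.
  by_cases hneg : ∃ y ∈ Set.Ioo a b, g y < 0
  · obtain ⟨y, hy, hgy⟩ := hneg
    have hnhds : {t | t ∈ Set.Ioo a b ∧ g t < 0} ∈ 𝓝 y :=
      inter_mem (Ioo_mem_nhds hy.1 hy.2) (h.continuous_drift.continuousAt.eventually_lt_const hgy)
    obtain ⟨δ, hδ, hball⟩ := Metric.nhds_basis_closedBall.mem_iff.1 hnhds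
    rw [Real.closedBall_eq_Icc] at hball
    have hl := hball (Set.left_mem_Icc.2 (by linarith))
    have hr := hball (Set.right_mem_Icc.2 (by linarith))
    obtain ⟨n, hn, hn'⟩ := (ha.and_eventually (h.eventually_no_ascent (p := y - δ) (q := y + δ)
      (by linarith) (ha0.le.trans hl.1.1.le) fun t ht => (hball ht).2.le)).exists
    obtain ⟨k, hk, hk'⟩ := (hb.and_eventually (eventually_ge_atTop n)).exists
    have := hn' (hn.le.trans hl.1.1.le) k hk'
    linarith [hr.1.2]
  · push Not at hneg
    obtain ⟨p, hap, hpb⟩ := exists_between hab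
    obtain ⟨q, hpq, hqb⟩ := exists_between hpb
    obtain ⟨n, hn, hn'⟩ := (hb.and_eventually (h.eventually_no_descent hpq (hqb.trans hbT).le
      fun t ht => hneg t ⟨hap.trans_le ht.1, ht.2.trans_lt hqb⟩)).exists
    obtain ⟨k, hk, hk'⟩ := (ha.and_eventually (eventually_ge_atTop n)).exists
    have := hn' (hqb.trans hn).le k hk'
    linarith

/-- Below `Tmax` the upper clip is eventually inactive, so `T + R` gains at least `ε n * (g x / 2)`
per step; being convergent, it would make `ε` summable. -/
lemma limit_eq_Tmax_of_drift_pos (h : ProjectedScheme Tmax g ε w T) {x : ℝ}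
    (hx : Tendsto T atTop (𝓝 x)) (hgx : 0 < g x) : x = Tmax := by
  have hxT : x ≤ Tmax := (isClosed_Icc.mem_of_tendsto hx h.eventually_mem).2
  by_contra hne
  have hlt : x < Tmax := lt_of_le_of_ne hxT hne
  obtain ⟨R, hR, hRw⟩ := h.exists_tail
  have hU : Tendsto (fun n => T n + R n) atTop (𝓝 x) := by simpa using hx.add hR
  have hev : ∀ᶠ n in atTop, g x / 2 < g (T n) ∧ T n + (ε n * g (T n) + w n) < Tmax :=
    (((h.continuous_drift.tendsto x).comp hx).eventually_const_lt (half_lt_self hgx)).and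
      (Tendsto.eventually_lt_const hlt (by simpa using hx.add h.increment_tendsto))
  obtain ⟨n₀, hn₀⟩ := eventually_atTop.1 hev
  have hgrow : ∀ n, g x / 2 * ∑ k ∈ Finset.range n, ε (k + n₀) ≤
      T (n + n₀) + R (n + n₀) - (T n₀ + R n₀) := by
    intro n
    induction n with
    | zero => simp
    | succ n ih =>
      obtain ⟨h1, h2⟩ := hn₀ (n + n₀) (Nat.le_add_left _ _)
      have hm := min_le_proj Tmax (T (n + n₀) + (ε (n + n₀) * g (T (n + n₀)) + w (n + n₀)))
      rw [← h.update, min_eq_left h2.le] at hm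
      have := mul_le_mul_of_nonneg_left h1.le (h.step_nonneg (n + n₀))
      have := hRw (n + n₀)
      rw [Finset.sum_range_succ, mul_add, show n + 1 + n₀ = n + n₀ + 1 by ring]
      linarith
  obtain ⟨B, hB⟩ := hU.bddAbove_range
  refine h.step_not_summable ((summable_nat_add_iff n₀).1
    (summable_of_sum_range_le (c := (B - (T n₀ + R n₀)) / (g x / 2))
      (fun n => h.step_nonneg _) fun n => ?_))
  rw [le_div_iff₀ (by linarith), mul_comm]
  have := hB (Set.mem_range_self (n + n₀))
  linarith [hgrow n]

lemma limit_eq_zero_of_drift_neg (h : ProjectedScheme Tmax g ε w T) {x : ℝ}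
    (hx : Tendsto T atTop (𝓝 x)) (hgx : g x < 0) : x = 0 := by
  have := h.reflect.limit_eq_Tmax_of_drift_pos (hx.const_sub Tmax) (by simpa using hgx)
  linarith

end ProjectedScheme

end TTL

/-! ### Almost sure convergence of the noise series -/

namespace TTL

section Martingale

variable {Ω : Type*} {mΩ : MeasurableSpace Ω} {μ : Measure Ω} [IsProbabilityMeasure μ]
  {ℱ : Filtration ℕ mΩ} {ε : ℕ → ℝ} {D : ℕ → Ω → ℝ}

lemma integral_mul_eq_zero_of_condExp_eq_zero {m : MeasurableSpace Ω} (hm : m ≤ mΩ) {f d : Ω → ℝ}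
    (hf : StronglyMeasurable[m] f) (hf2 : MemLp f 2 μ) (hd2 : MemLp d 2 μ)
    (hd : μ[d | m] =ᵐ[μ] 0) : ∫ ω, f ω * d ω ∂μ = 0 := by
  have hfd : Integrable (f * d) μ := hf2.integrable_mul hd2
  have h1 : μ[f * d | m] =ᵐ[μ] 0 := by
    filter_upwards [condExp_mul_of_stronglyMeasurable_left hf hfd (hd2.integrable one_le_two), hd]
      with ω h1 h2
    simp [h1, h2]
  calc ∫ ω, f ω * d ω ∂μ = ∫ ω, (μ[f * d | m]) ω ∂μ := (integral_condExp hm).symm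
    _ = 0 := by rw [integral_congr_ae h1]; simp

/-- A series of square-integrable martingale differences with uniformly bounded second moments
and square-summable weights converges almost surely. -/
theorem ae_exists_tendsto_sum_of_martingale_difference
    (hε : Summable fun n => ε n ^ 2) (hD : ∀ n, StronglyMeasurable[ℱ (n + 1)] (D n))
    (hD2 : ∀ n, MemLp (D n) 2 μ) {B : ℝ} (hB : ∀ n, ∫ ω, D n ω ^ 2 ∂μ ≤ B)
    (hcond : ∀ n, μ[D n | ℱ n] =ᵐ[μ] 0) :
    ∀ᵐ ω ∂μ, ∃ s, Tendsto (fun n => ∑ k ∈ Finset.range n, ε k * D k ω) atTop (𝓝 s) := by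
  set M : ℕ → Ω → ℝ := fun n ω => ∑ k ∈ Finset.range n, ε k * D k ω with hM
  have hMsucc : ∀ n, M (n + 1) = M n + ε n • D n := fun n => by
    funext ω
    simp [hM, Finset.sum_range_succ]
  have hMm : ∀ n, StronglyMeasurable[ℱ n] (M n) := fun n =>
    Finset.stronglyMeasurable_fun_sum _ fun k hk =>
      ((hD k).mono (ℱ.mono (Finset.mem_range.1 hk))).const_mul (ε k)
  have hM2 : ∀ n, MemLp (M n) 2 μ := fun n =>
    memLp_finsetSum _ fun k _ => (hD2 k).const_mul (ε k)
  have hmart : Martingale M ℱ μ := by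
    refine martingale_of_condExp_sub_eq_zero_nat hMm (fun n => (hM2 n).integrable one_le_two)
      fun n => ?_
    rw [hMsucc, add_sub_cancel_left]
    filter_upwards [condExp_smul (μ := μ) (ε n) (D n) (ℱ n), hcond n] with ω h1 h2
    simp [h1, h2]
  -- Orthogonality of increments: the cross term integrates to zero.
  have hsecond : ∀ n, ∫ ω, M n ω ^ 2 ∂μ ≤ (∑ k ∈ Finset.range n, ε k ^ 2) * B := by
    intro n
    induction n with
    | zero => simp [hM]
    | succ n ih =>
      have horth := integral_mul_eq_zero_of_condExp_eq_zero (ℱ.le n) (hMm n) (hM2 n) (hD2 n)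
        (hcond n)
      have hMD : Integrable (fun ω => M n ω * D n ω) μ := (hM2 n).integrable_mul (hD2 n)
      have hexp : ∀ ω, M (n + 1) ω ^ 2 =
          M n ω ^ 2 + (2 * ε n * (M n ω * D n ω) + ε n ^ 2 * D n ω ^ 2) := fun ω => by
        rw [hMsucc]
        simp only [Pi.add_apply, Pi.smul_apply, smul_eq_mul]
        ring
      simp_rw [hexp]
      have hi1 : Integrable (fun ω => 2 * ε n * (M n ω * D n ω)) μ := hMD.const_mul _
      have hi2 : Integrable (fun ω => ε n ^ 2 * D n ω ^ 2) μ := (hD2 n).integrable_sq.const_mul _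
      have hi3 : Integrable (fun ω => 2 * ε n * (M n ω * D n ω) + ε n ^ 2 * D n ω ^ 2) μ :=
        hi1.add hi2
      rw [integral_add (hM2 n).integrable_sq hi3, integral_add hi1 hi2,
        integral_const_mul, integral_const_mul, horth, Finset.sum_range_succ, add_mul]
      have := mul_le_mul_of_nonneg_left (hB n) (sq_nonneg (ε n))
      linarith
  have hB0 : 0 ≤ B := (integral_nonneg fun ω => sq_nonneg _).trans (hB 0)
  -- The L² bound yields the L¹ bound needed for martingale convergence through `|x| ≤ 1 + x ^ 2`.
  have hone : ∀ n, eLpNorm (M n) 1 μ ≤ ((1 + (∑' k, ε k ^ 2) * B).toNNReal : ℝ≥0∞) := by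
    intro n
    have hint := (hM2 n).integrable one_le_two
    rw [eLpNorm_one_eq_lintegral_enorm, ← ofReal_integral_norm_eq_lintegral_enorm hint]
    refine ENNReal.ofReal_le_ofReal ?_
    calc ∫ ω, ‖M n ω‖ ∂μ ≤ ∫ ω, (1 + M n ω ^ 2) ∂μ := by
          refine integral_mono hint.norm ((integrable_const 1).add (hM2 n).integrable_sq) fun ω => ?_
          simp only [Real.norm_eq_abs]
          nlinarith [sq_abs (M n ω), sq_nonneg (|M n ω| - 1)]
      _ = 1 + ∫ ω, M n ω ^ 2 ∂μ := by
          rw [integral_add (integrable_const 1) (hM2 n).integrable_sq]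
          simp
      _ ≤ 1 + (∑' k, ε k ^ 2) * B := by
          have := mul_le_mul_of_nonneg_right
            (hε.sum_le_tsum (Finset.range n) fun k _ => sq_nonneg (ε k)) hB0
          linarith [hsecond n]
  exact hmart.submartingale.exists_ae_tendsto_of_bdd hone

end Martingale

end TTL

/-! ### The drift and the derivative of the cost -/

namespace TTL

section Drift

variable {N : ℕ} {lam m c : Fin N → ℝ}

/-- The mean correction when the timer is `t`. -/
noncomputable def drift (lam m c : Fin N → ℝ) (t : ℝ) : ℝ :=
  ∑ i, missProb lam t i * (lam i * m i - c i)

/-- The total miss rate when the timer is `t`. -/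
noncomputable def missRate (lam : Fin N → ℝ) (t : ℝ) : ℝ :=
  ∑ j, lam j * Real.exp (-lam j * t)

lemma missRate_pos [Nonempty (Fin N)] (hlam : ∀ i, 0 < lam i) (t : ℝ) : 0 < missRate lam t :=
  Finset.sum_pos (fun j _ => mul_pos (hlam j) (Real.exp_pos _)) Finset.univ_nonempty

lemma continuous_missProb [Nonempty (Fin N)] (hlam : ∀ i, 0 < lam i) (i : Fin N) :
    Continuous fun t => missProb lam t i :=
  Continuous.div (by fun_prop) (by fun_prop) fun t => (missRate_pos hlam t).ne'

lemma continuous_drift [Nonempty (Fin N)] (hlam : ∀ i, 0 < lam i) : Continuous (drift lam m c) :=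
  continuous_finsetSum _ fun i _ => (continuous_missProb hlam i).mul continuous_const

lemma missProb_mem_Icc [Nonempty (Fin N)] (hlam : ∀ i, 0 < lam i) (t : ℝ) (i : Fin N) :
    missProb lam t i ∈ Set.Icc 0 1 := by
  have hnn : ∀ j, 0 ≤ lam j * Real.exp (-lam j * t) := fun j =>
    mul_nonneg (hlam j).le (Real.exp_pos _).le
  refine ⟨div_nonneg (hnn i) (missRate_pos hlam t).le, (div_le_one (missRate_pos hlam t)).2 ?_⟩
  exact Finset.single_le_sum (fun j _ => hnn j) (Finset.mem_univ i)

lemma abs_drift_le [Nonempty (Fin N)] (hlam : ∀ i, 0 < lam i) (t : ℝ) :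
    |drift lam m c t| ≤ ∑ i, |lam i * m i - c i| := by
  refine (Finset.abs_sum_le_sum_abs _ _).trans (Finset.sum_le_sum fun i _ => ?_)
  obtain ⟨h0, h1⟩ := missProb_mem_Icc hlam t i
  rw [abs_mul, abs_of_nonneg h0]
  exact mul_le_of_le_one_left (abs_nonneg _) h1

lemma hasDerivAt_cost [Nonempty (Fin N)] (hlam : ∀ i, 0 < lam i) (t : ℝ) :
    HasDerivAt (cost lam m c) (-(missRate lam t * drift lam m c t)) t := by
  have h : HasDerivAt (cost lam m c)
      (∑ i, (lam i * m i - c i) * (Real.exp (-lam i * t) * -lam i)) t := by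
    refine HasDerivAt.fun_sum fun i _ => ?_
    have := ((hasDerivAt_id t).const_mul (-lam i)).exp.const_mul (lam i * m i - c i)
    simpa using this.const_add (c i)
  convert h using 1
  unfold drift
  rw [Finset.mul_sum, ← Finset.sum_neg_distrib]
  refine Finset.sum_congr rfl fun i _ => ?_
  have hS := (missRate_pos hlam t).ne'
  have : missRate lam t * missProb lam t i = lam i * Real.exp (-lam i * t) :=
    mul_div_cancel₀ _ hS
  rw [← mul_assoc, this]
  ring

end Drift

/-- A function with positive derivative at the left end of an interval has a local minimum there. -/
lemma isLocalMinOn_left_of_deriv_pos {f : ℝ → ℝ} {f' a b : ℝ} (hf : HasDerivAt f f' a)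
    (hf' : 0 < f') : IsLocalMinOn f (Set.Icc a b) a := by
  have h := (hasDerivAt_iff_tendsto_slope.1 hf).eventually_const_lt hf'
  rw [eventually_nhdsWithin_iff] at h
  refine eventually_nhdsWithin_iff.2 (h.mono fun t ht hmem => ?_)
  rcases hmem.1.eq_or_lt with rfl | hlt
  · exact le_rfl
  · have := ht hlt.ne'
    rw [slope_def_field, div_pos_iff_of_pos_right (sub_pos.2 hlt)] at this
    linarith

/-- A function with negative derivative at the right end of an interval has a local minimum
there. -/
lemma isLocalMinOn_right_of_deriv_neg {f : ℝ → ℝ} {f' a b : ℝ} (hf : HasDerivAt f f' b)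
    (hf' : f' < 0) : IsLocalMinOn f (Set.Icc a b) b := by
  have h := (hasDerivAt_iff_tendsto_slope.1 hf).eventually_lt_const hf'
  rw [eventually_nhdsWithin_iff] at h
  refine eventually_nhdsWithin_iff.2 (h.mono fun t ht hmem => ?_)
  rcases hmem.2.eq_or_lt with rfl | hlt
  · exact le_rfl
  · have := ht hlt.ne
    rw [slope_def_field, div_neg_iff] at this
    rcases this with h1 | h1 <;> linarith [h1.1, h1.2]

/-! ### Conditional mean of the correction -/

section Correction

variable {Ω : Type*} {mΩ : MeasurableSpace Ω} {μ : Measure Ω} [IsProbabilityMeasure μ]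
  {N : ℕ} {lam m c : Fin N → ℝ}

lemma measurable_eval_index {m₀ : MeasurableSpace Ω} {r : Ω → Fin N} {f : Fin N → Ω → ℝ}
    (hr : Measurable[m₀] r) (hf : ∀ i, Measurable[m₀] (f i)) :
    Measurable[m₀] fun ω => f (r ω) ω := by
  have h : Measurable fun p : Fin N × Ω => f p.1 p.2 := measurable_from_prod_countable_right hf
  exact h.comp (hr.prodMk measurable_id)

/-- The conditional mean of a function of a finite random index, given the conditional
probabilities of the index. -/
lemma condExp_comp_index {m₀ : MeasurableSpace Ω} {r : Ω → Fin N}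
    (hr : Measurable[mΩ] r) {p : Fin N → Ω → ℝ}
    (hp : ∀ i, μ[(r ⁻¹' {i}).indicator (fun _ => (1 : ℝ)) | m₀] =ᵐ[μ] p i) (a : Fin N → ℝ) :
    μ[fun ω => a (r ω) | m₀] =ᵐ[μ] fun ω => ∑ i, p i ω * a i := by
  have hdecomp : (fun ω => a (r ω)) =
      ∑ i, a i • (r ⁻¹' {i}).indicator (fun _ => (1 : ℝ)) := by
    funext ω
    rw [Finset.sum_apply, Finset.sum_eq_single (r ω)]
    · simp
    · intro i _ hi
      have : ω ∉ r ⁻¹' {i} := fun h => hi h.symm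
      simp [Set.indicator_of_notMem this]
    · simp
  have hint : ∀ i, Integrable ((r ⁻¹' {i}).indicator (fun _ => (1 : ℝ))) μ := fun i =>
    (integrable_const 1).indicator (hr (measurableSet_singleton i))
  have hall : ∀ᵐ ω ∂μ, ∀ i,
      (μ[a i • (r ⁻¹' {i}).indicator (fun _ => (1 : ℝ)) | m₀]) ω = p i ω * a i := by
    refine ae_all_iff.2 fun i => ?_
    filter_upwards [condExp_smul (μ := μ) (a i) ((r ⁻¹' {i}).indicator (fun _ => (1 : ℝ))) m₀, hp i]
      with ω h1 h2
    rw [h1, Pi.smul_apply, h2, smul_eq_mul, mul_comm]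
  rw [hdecomp]
  filter_upwards [condExp_finsetSum (μ := μ) (fun i (_ : i ∈ Finset.univ) => (hint i).smul (a i))
    m₀, hall] with ω h1 h2
  rw [h1, Finset.sum_apply]
  exact Finset.sum_congr rfl fun i _ => h2 i

/-- The conditional mean of the correction given the history is the drift. -/
lemma condExp_correction {m₀ : MeasurableSpace Ω} (hm₀ : m₀ ≤ mΩ) {r : Ω → Fin N} {Y t : Ω → ℝ}
    (hr : Measurable[mΩ] r) (hY : Integrable Y μ)
    (hmiss : ∀ i, μ[(r ⁻¹' {i}).indicator (fun _ => (1 : ℝ)) | m₀]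
      =ᵐ[μ] fun ω => missProb lam (t ω) i)
    (hunbiased : μ[Y | m₀ ⊔ MeasurableSpace.comap r inferInstance] =ᵐ[μ] fun ω => lam (r ω)) :
    μ[fun ω => correction m c (r ω) (Y ω) | m₀] =ᵐ[μ] fun ω => drift lam m c (t ω) := by
  set G : MeasurableSpace Ω := m₀ ⊔ MeasurableSpace.comap r inferInstance with hG
  have hGm : G ≤ mΩ := sup_le hm₀ hr.comap_le
  have hrG : Measurable[G] r := (comap_measurable r).mono le_sup_right le_rfl
  have hcomp : ∀ a : Fin N → ℝ, StronglyMeasurable[G] fun ω => a (r ω) := fun a =>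
    ((measurable_of_finite a).comp hrG).stronglyMeasurable
  have hcint : ∀ a : Fin N → ℝ, Integrable (fun ω => a (r ω)) μ := fun a =>
    Integrable.of_bound ((hcomp a).mono hGm).aestronglyMeasurable (∑ i, ‖a i‖)
      (ae_of_all _ fun ω => Finset.single_le_sum (f := fun i => ‖a i‖)
        (fun i _ => norm_nonneg _) (Finset.mem_univ (r ω)))
  have hbound : ∀ᵐ ω ∂μ, ‖m (r ω)‖ ≤ ∑ i, ‖m i‖ := ae_of_all _ fun ω =>
    Finset.single_le_sum (f := fun i => ‖m i‖) (fun i _ => norm_nonneg _) (Finset.mem_univ (r ω))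
  have hmY : Integrable ((fun ω => m (r ω)) * Y) μ :=
    hY.bdd_mul ((hcomp m).mono hGm).aestronglyMeasurable hbound
  have hX : (fun ω => correction m c (r ω) (Y ω)) =
      (fun ω => m (r ω)) * Y - fun ω => c (r ω) := by
    funext ω
    simp [correction, mul_comm]
  -- Given the missed content as well, its costs are known and only the estimate is averaged; the
  -- tower property then averages over the content.
  have hin : μ[fun ω => correction m c (r ω) (Y ω) | G] =ᵐ[μ]
      fun ω => lam (r ω) * m (r ω) - c (r ω) := by
    rw [hX]
    filter_upwards [condExp_sub hmY (hcint c) G,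
      condExp_stronglyMeasurable_mul_of_bound hGm (hcomp m) hY _ hbound, hunbiased] with ω h1 h2 h3
    rw [h1, Pi.sub_apply, h2, Pi.mul_apply, h3,
      condExp_of_stronglyMeasurable hGm (hcomp c) (hcint c), mul_comm]
  exact ((condExp_condExp_of_le le_sup_left hGm).symm.trans (condExp_congr_ae hin)).trans
    (condExp_comp_index hr hmiss fun i => lam i * m i - c i)

end Correction

lemma integral_sq_le_of_eLpNorm_le {Ω : Type*} {mΩ : MeasurableSpace Ω} {μ : Measure Ω}
    {Y : Ω → ℝ} (hY : MemLp Y 2 μ) {K : ℝ≥0} (hK : eLpNorm Y 2 μ ≤ K) : ∫ ω, Y ω ^ 2 ∂μ ≤ (K : ℝ) ^ 2 := by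
  rw [hY.eLpNorm_eq_integral_rpow_norm two_ne_zero ENNReal.ofNat_ne_top] at hK
  have h0 : 0 ≤ ∫ ω, Y ω ^ 2 ∂μ := integral_nonneg fun ω => sq_nonneg _
  have h1 := ENNReal.toReal_mono ENNReal.coe_ne_top hK
  simp only [ENNReal.toReal_ofNat, Real.rpow_two, Real.norm_eq_abs, sq_abs,
    ENNReal.coe_toReal] at h1
  rw [ENNReal.toReal_ofReal (Real.rpow_nonneg h0 _), ← one_div, ← Real.sqrt_eq_rpow] at h1
  calc ∫ ω, Y ω ^ 2 ∂μ = √(∫ ω, Y ω ^ 2 ∂μ) ^ 2 := (Real.sq_sqrt h0).symm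
    _ ≤ (K : ℝ) ^ 2 := pow_le_pow_left₀ (Real.sqrt_nonneg _) h1 2

end TTL

theorem proposition1
    {Ω : Type*} [mΩ : MeasurableSpace Ω] (μ : Measure Ω) [IsProbabilityMeasure μ]
    -- the history available at each step
    (ℱ : Filtration ℕ mΩ)
    -- contents, with request rates, miss costs and storage costs
    {N : ℕ} (lam m c : Fin N → ℝ) (hlam : ∀ i, 0 < lam i)
    (Tmax : ℝ) (hTmax : 0 ≤ Tmax)
    -- step sizes
    (ε : ℕ → ℝ) (hε_nonneg : ∀ n, 0 ≤ ε n) (hε_sum : ¬ Summable ε)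
    (hε_sq : Summable fun n => ε n ^ 2)
    -- `r n` is the content missed at step `n`, `lamHat n i` the estimate of `lam i` at step `n`,
    -- `T n` the timer
    (r : ℕ → Ω → Fin N) (lamHat : ℕ → Fin N → Ω → ℝ) (T : ℕ → Ω → ℝ)
    (hT0 : Measurable[ℱ 0] (T 0))
    (hr : ∀ n, Measurable[ℱ (n + 1)] (r n))
    (hlamHat : ∀ n i, Measurable[ℱ (n + 1)] (lamHat n i))
    -- given the history, the miss is for content `i` with probability `missProb lam (T n) i`
    (hmiss : ∀ n i, μ[(r n ⁻¹' {i}).indicator (fun _ => (1 : ℝ)) | ℱ n]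
      =ᵐ[μ] fun ω => TTL.missProb lam (T n ω) i)
    -- the estimates have uniformly bounded second moments
    (hmoment : ∃ K : ℝ≥0, ∀ n, eLpNorm (fun ω => lamHat n (r n ω) ω) 2 μ ≤ K)
    -- given the history and the missed content, the estimate of its rate is unbiased
    (hunbiased : ∀ n,
      μ[fun ω => lamHat n (r n ω) ω | ℱ n ⊔ MeasurableSpace.comap (r n) inferInstance]
        =ᵐ[μ] fun ω => lam (r n ω))
    -- the projected update rule
    (hT : ∀ n ω, T (n + 1) ω =
      TTL.proj Tmax (T n ω + ε n * TTL.correction m c (r n ω) (lamHat n (r n ω) ω))) :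
    ∀ᵐ ω ∂μ, ∃ x ∈ Set.Icc 0 Tmax, Tendsto (fun n => T n ω) atTop (𝓝 x) ∧
      (HasDerivAt (TTL.cost lam m c) 0 x ∨
        (x = 0 ∧ IsLocalMinOn (TTL.cost lam m c) (Set.Icc 0 Tmax) 0) ∨
        (x = Tmax ∧ IsLocalMinOn (TTL.cost lam m c) (Set.Icc 0 Tmax) Tmax)) := by
  obtain ⟨ω₀⟩ : Nonempty Ω := nonempty_of_isProbabilityMeasure μ
  -- `N ≥ 1` follows from the existence of a missed content.
  have : Nonempty (Fin N) := ⟨r 0 ω₀⟩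
  obtain ⟨K, hK⟩ := hmoment
  set g : ℝ → ℝ := TTL.drift lam m c with hg
  have hgc : Continuous g := TTL.continuous_drift hlam
  set Y : ℕ → Ω → ℝ := fun n ω => lamHat n (r n ω) ω with hYdef
  have hYm : ∀ n, Measurable[ℱ (n + 1)] (Y n) := fun n =>
    TTL.measurable_eval_index (hr n) (hlamHat n)
  have hY2 : ∀ n, MemLp (Y n) 2 μ := fun n =>
    ⟨((hYm n).mono (ℱ.le _) le_rfl).aestronglyMeasurable, (hK n).trans_lt ENNReal.coe_lt_top⟩
  have hTm : ∀ n, Measurable[ℱ n] (T n) := by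
    intro n
    induction n with
    | zero => exact hT0
    | succ n ih =>
      have hfun : T (n + 1) = fun ω => TTL.proj Tmax
          (T n ω + ε n * TTL.correction m c (r n ω) (lamHat n (r n ω) ω)) := funext (hT n)
      have hTn : Measurable[ℱ (n + 1)] (T n) := ih.mono (ℱ.mono n.le_succ) le_rfl
      have hmr : Measurable[ℱ (n + 1)] fun ω => m (r n ω) := (measurable_of_finite m).comp (hr n)
      have hcr : Measurable[ℱ (n + 1)] fun ω => c (r n ω) := (measurable_of_finite c).comp (hr n)
      rw [hfun]
      exact (measurable_const.max (hTn.add ((((hYm n).mul hmr).sub hcr).const_mul (ε n)))).min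
        measurable_const
  set D : ℕ → Ω → ℝ := fun n ω => TTL.correction m c (r n ω) (Y n ω) - g (T n ω) with hD
  have hXm : ∀ n, Measurable[ℱ (n + 1)] fun ω => TTL.correction m c (r n ω) (Y n ω) := fun n =>
    ((hYm n).mul ((measurable_of_finite m).comp (hr n))).sub ((measurable_of_finite c).comp (hr n))
  have hDm : ∀ n, StronglyMeasurable[ℱ (n + 1)] (D n) := fun n =>
    ((hXm n).sub (hgc.measurable.comp
      ((hTm n).mono (ℱ.mono n.le_succ) le_rfl))).stronglyMeasurable
  set A : ℝ := ∑ i, |m i| with hA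
  set B : ℝ := ∑ i, |c i| + ∑ i, |lam i * m i - c i| with hB
  have hDle : ∀ n ω, |D n ω| ≤ A * |Y n ω| + B := by
    intro n ω
    have h1 : |m (r n ω)| ≤ A :=
      Finset.single_le_sum (f := fun i => |m i|) (fun i _ => abs_nonneg _) (Finset.mem_univ (r n ω))
    have h2 : |c (r n ω)| ≤ ∑ i, |c i| :=
      Finset.single_le_sum (f := fun i => |c i|) (fun i _ => abs_nonneg _) (Finset.mem_univ (r n ω))
    have h3 : |g (T n ω)| ≤ _ := TTL.abs_drift_le hlam (T n ω)
    have h4 := abs_sub (Y n ω * m (r n ω) - c (r n ω)) (g (T n ω))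
    have h5 := abs_sub (Y n ω * m (r n ω)) (c (r n ω))
    rw [abs_mul] at h5
    have h6 := mul_le_mul_of_nonneg_left h1 (abs_nonneg (Y n ω))
    simp only [hD, TTL.correction]
    linarith
  have hDsq : ∀ n ω, D n ω ^ 2 ≤ 2 * A ^ 2 * Y n ω ^ 2 + 2 * B ^ 2 := by
    intro n ω
    have h1 := pow_le_pow_left₀ (abs_nonneg _) (hDle n ω) 2
    have h2 := sq_nonneg (A * |Y n ω| - B)
    rw [sq_abs] at h1
    rw [← sq_abs (Y n ω)]
    linarith
  have hdom : ∀ n, Integrable (fun ω => 2 * A ^ 2 * Y n ω ^ 2 + 2 * B ^ 2) μ := fun n =>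
    ((hY2 n).integrable_sq.const_mul _).add (integrable_const _)
  have hDaesm : ∀ n, AEStronglyMeasurable (D n) μ := fun n =>
    ((hDm n).mono (ℱ.le _)).aestronglyMeasurable
  have hD2 : ∀ n, MemLp (D n) 2 μ := fun n =>
    (memLp_two_iff_integrable_sq (hDaesm n)).2 <|
      (hdom n).mono' ((hDaesm n).pow 2) (ae_of_all _ fun ω => by
        rw [Real.norm_of_nonneg (sq_nonneg _)]
        exact hDsq n ω)
  have hDB : ∀ n, ∫ ω, D n ω ^ 2 ∂μ ≤ 2 * A ^ 2 * (K : ℝ) ^ 2 + 2 * B ^ 2 := by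
    intro n
    refine (integral_mono (hD2 n).integrable_sq (hdom n) (hDsq n)).trans ?_
    rw [integral_add ((hY2 n).integrable_sq.const_mul _) (integrable_const _), integral_const_mul]
    have := mul_le_mul_of_nonneg_left (TTL.integral_sq_le_of_eLpNorm_le (hY2 n) (hK n))
      (by positivity : 0 ≤ 2 * A ^ 2)
    simpa using this
  have hgint : ∀ n, Integrable (fun ω => g (T n ω)) μ := fun n =>
    Integrable.of_bound
      (hgc.measurable.comp ((hTm n).mono (ℱ.le n) le_rfl)).aestronglyMeasurable
      _ (ae_of_all _ fun ω => TTL.abs_drift_le hlam (T n ω))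
  have hXint : ∀ n, Integrable (fun ω => TTL.correction m c (r n ω) (Y n ω)) μ := fun n => by
    have := ((hD2 n).integrable one_le_two).add (hgint n)
    simpa [hD, Pi.add_def] using this
  have hcond : ∀ n, μ[D n | ℱ n] =ᵐ[μ] 0 := by
    intro n
    have hgm : StronglyMeasurable[ℱ n] fun ω => g (T n ω) :=
      (hgc.measurable.comp (hTm n)).stronglyMeasurable
    filter_upwards [condExp_sub (hXint n) (hgint n) (ℱ n),
      TTL.condExp_correction (m := m) (c := c) (ℱ.le n) ((hr n).mono (ℱ.le _) le_rfl)
        ((hY2 n).integrable one_le_two) (hmiss n) (hunbiased n)] with ω h1 h2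
    refine h1.trans ?_
    rw [Pi.sub_apply, h2, condExp_of_stronglyMeasurable (ℱ.le n) hgm (hgint n)]
    simp [hg]
  filter_upwards [TTL.ae_exists_tendsto_sum_of_martingale_difference hε_sq hDm hD2 hDB hcond]
    with ω hω
  have hε0 : Tendsto ε atTop (𝓝 0) := by
    have h := hε_sq.tendsto_atTop_zero.sqrt
    simpa [Real.sqrt_sq (hε_nonneg _)] using h
  have hscheme : TTL.ProjectedScheme Tmax g ε (fun n => ε n * D n ω) (fun n => T n ω) :=
    { Tmax_nonneg := hTmax
      continuous_drift := hgc
      step_nonneg := hε_nonneg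
      step_tendsto := hε0
      step_not_summable := hε_sum
      noise_converges := hω
      update := fun n => by
        rw [hT]
        congr 2
        simp only [hD, hYdef]
        ring }
  obtain ⟨x, hx, hlim⟩ := hscheme.exists_tendsto
  refine ⟨x, hx, hlim, ?_⟩
  have hderiv := TTL.hasDerivAt_cost (m := m) (c := c) hlam x
  have hS := TTL.missRate_pos hlam x
  -- `C' x` has the sign opposite to `g x`.
  rcases lt_trichotomy (g x) 0 with hneg | hzero | hpos
  · obtain rfl := hscheme.limit_eq_zero_of_drift_neg hlim hneg
    exact Or.inr (Or.inl ⟨rfl, TTL.isLocalMinOn_left_of_deriv_pos hderiv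
      (neg_pos.2 (mul_neg_of_pos_of_neg hS hneg))⟩)
  · rw [← hg, hzero, mul_zero, neg_zero] at hderiv
    exact Or.inl hderiv
  · have hxT := hscheme.limit_eq_Tmax_of_drift_pos hlim hpos
    refine Or.inr (Or.inr ⟨hxT, ?_⟩)
    rw [← hxT]
    exact TTL.isLocalMinOn_right_of_deriv_neg hderiv (neg_neg_of_pos (mul_pos hS hpos))
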